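/- Let $F$ be a real homogeneous polynomial of degree $d\ge 1$ on $\mathbb{R}^n$ and let $\Gamma\subset\mathbb{R}^n$ be a lattice of full rank, i.e. $\Gamma=\{\sum_{j=1}^n \ell_j v_j:\ \ell_j\in\mathbb{Z}\}$ for some linearly independent vectors $v_1,\dots,v_n\in\mathbb{R}^n$. Let $\Gamma^*=\{\xi\in\mathbb{R}^n:\ \xi\cdot y\in\mathbb{Z}\ \text{for all } y\in\Gamma\}$ be the dual lattice and let $\mathrm{Vol}(\Gamma^*)$ be the Lebesgue measure of a fundamental domain of $\Gamma^*$. For $R>0$ put $F_R=F\chi_R$, where $\chi_R$ is the characteristic function of the closed Euclidean ball of radius $R$ centred at the origin, and let $\mathbb{B}^n_1$ be the unit ball of $\mathbb{R}^n$ centred at the origin. Then the weighted lattice point counting function $$\mathscr{M}(R)=\sum_{\lambda\in\Gamma}F_R(\lambda)=\sum_{\lambda\in\Gamma,\ |\lambda|\le R}F(\lambda)$$ satisfies $$\mathscr{M}(R)=\Bigl(\mathrm{Vol}(\Gamma^*)\int_{\mathbb{B}^n_1}F(x)\,dx\Bigr)R^{d+n}+O\bigl(R^{d+n-\frac{2}{n+1}}\bigr)\qquad\text{as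 } R\to\infty .$$ Moreover, for every fixed $h\in\mathbb{R}^n$, the shifted counting function $\mathscr{M}^h(R)=\sum_{\lambda\in\Gamma}F_R(\lambda+h)$ satisfies $$\mathscr{M}^h(R)=\Bigl(\mathrm{Vol}(\Gamma^*)\int_{\mathbb{B}^n_1}F(x)\,dx\Bigr)R^{d+n}+O\bigl(R^{d+n-\frac{2}{n+1}}\bigr)\qquad\text{as } R\to\infty .$$ -/

import Mathlib

open Filter Asymptotics MeasureTheory

noncomputable section

/-- The dual lattice `Γ* = {ξ : ⟪ξ, y⟫ ∈ ℤ for all y ∈ Γ}` of a subgroup `Γ` of `ℝⁿ`, with respect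
to the standard inner product. -/
def dualLattice {n : ℕ} (Γ : Submodule ℤ (EuclideanSpace ℝ (Fin n))) :
    Submodule ℤ (EuclideanSpace ℝ (Fin n)) :=
  LinearMap.BilinForm.dualSubmodule (innerₗ (EuclideanSpace ℝ (Fin n))) Γ

theorem mem_dualLattice {n : ℕ} (Γ : Submodule ℤ (EuclideanSpace ℝ (Fin n)))
    (ξ : EuclideanSpace ℝ (Fin n)) :
    ξ ∈ dualLattice Γ ↔ ∀ y ∈ Γ, ∃ k : ℤ, inner ℝ ξ y = (k : ℝ) := by
  simp [dualLattice, LinearMap.BilinForm.mem_dualSubmodule, Submodule.mem_one, eq_comm]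

/-- The polynomial function on `ℝⁿ` given by a polynomial in `n` variables. -/
def polyFun {n : ℕ} (F : MvPolynomial (Fin n) ℝ) (x : EuclideanSpace ℝ (Fin n)) : ℝ :=
  MvPolynomial.eval (fun i => x i) F

/-- `F_R = F · χ_R`, where `χ_R` is the characteristic function of the closed ball of radius `R`
centred at the origin. -/
def truncatedPoly {n : ℕ} (F : MvPolynomial (Fin n) ℝ) (R : ℝ) :
    EuclideanSpace ℝ (Fin n) → ℝ :=
  (Metric.closedBall (0 : EuclideanSpace ℝ (Fin n)) R).indicator (polyFun F)

/-- The weighted counting function `M(R) = ∑_{λ ∈ Γ} F_R(λ)`; only finitely many terms are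
nonzero when `Γ` is a lattice. -/
def weightedCount {n : ℕ} (F : MvPolynomial (Fin n) ℝ)
    (Γ : Submodule ℤ (EuclideanSpace ℝ (Fin n))) (R : ℝ) : ℝ :=
  ∑' v : Γ, truncatedPoly F R (v : EuclideanSpace ℝ (Fin n))

/-- The shifted weighted counting function `M^h(R) = ∑_{λ ∈ Γ} F_R(λ + h)`. -/
def shiftedWeightedCount {n : ℕ} (F : MvPolynomial (Fin n) ℝ)
    (Γ : Submodule ℤ (EuclideanSpace ℝ (Fin n))) (h : EuclideanSpace ℝ (Fin n)) (R : ℝ) : ℝ :=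
  ∑' v : Γ, truncatedPoly F R ((v : EuclideanSpace ℝ (Fin n)) + h)

/-- The sums defining the (shifted) counting functions are finite sums. -/
theorem finite_support_truncatedPoly {n : ℕ} (F : MvPolynomial (Fin n) ℝ)
    (Γ : Submodule ℤ (EuclideanSpace ℝ (Fin n))) [DiscreteTopology Γ]
    (h : EuclideanSpace ℝ (Fin n)) (R : ℝ) :
    (Function.support
      fun v : Γ => truncatedPoly F R ((v : EuclideanSpace ℝ (Fin n)) + h)).Finite := by
  have hfin : (Metric.closedBall (-h) R ∩ (Γ : Set (EuclideanSpace ℝ (Fin n)))).Finite := by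
    have : DiscreteTopology Γ.toAddSubgroup := inferInstanceAs (DiscreteTopology Γ)
    have hcl : IsClosed (Γ : Set (EuclideanSpace ℝ (Fin n))) :=
      AddSubgroup.isClosed_of_discrete (H := Γ.toAddSubgroup)
    exact Metric.finite_isBounded_inter_isClosed (isDiscrete_iff_discreteTopology.mpr ‹_›)
      Metric.isBounded_closedBall hcl
  refine (hfin.preimage (f := fun v : Γ => (v : EuclideanSpace ℝ (Fin n)))
    Subtype.val_injective.injOn).subset ?_
  intro v hv
  have hv' := Set.mem_of_indicator_ne_zero hv
  refine ⟨?_, v.2⟩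
  simpa [Metric.mem_closedBall, dist_eq_norm] using hv'

end

/-!
Cut the space into the translates `v + D`, `v ∈ Γ`, of a fundamental domain `D` contained in the
ball of radius `C`. On a translate inside the ball of radius `R`, the Lipschitz constant
`O(R ^ (d - 1))` of the homogeneous function `F` bounds the difference between `F` and its value at
the lattice point. The translates that meet the sphere of radius `R` lie in the shell
`R - C ≤ ‖x‖ ≤ R + C`, which has volume `O(R ^ (n - 1))`, and there `F = O(R ^ d)`. Both errors add
up to `O(R ^ (d + n - 1))`, and `2 / (n + 1) ≤ 1` as soon as `1 ≤ n`. The constant comes from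
rescaling the integral to the unit ball and from the fact that dual bases have inverse determinants.
-/

open Module Metric

section Covolume

variable {E : Type*} [NormedAddCommGroup E] [InnerProductSpace ℝ E]

theorem nondegenerate_innerₗ : (innerₗ E).Nondegenerate :=
  ⟨fun x hx => inner_self_eq_zero.1 (hx x), fun x hx => inner_self_eq_zero.1 (hx x)⟩

theorem det_dualBasis_mul_det {ι : Type*} [Fintype ι] [DecidableEq ι]
    (e : OrthonormalBasis ι ℝ E) (b : Basis ι ℝ E) :
    e.toBasis.det (LinearMap.BilinForm.dualBasis (innerₗ E) nondegenerate_innerₗ b) *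
      e.toBasis.det b = 1 := by
  set c := LinearMap.BilinForm.dualBasis (innerₗ E) nondegenerate_innerₗ b
  have pairing : (e.toBasis.toMatrix c).transpose * e.toBasis.toMatrix b = 1 := by
    ext i j
    have hcb : inner ℝ (c i) (b j) = if j = i then 1 else 0 :=
      LinearMap.BilinForm.apply_dualBasis_left nondegenerate_innerₗ b i j
    simp only [Matrix.mul_apply, Matrix.transpose_apply, Basis.toMatrix_apply,
      OrthonormalBasis.coe_toBasis_repr_apply, OrthonormalBasis.repr_apply_apply,
      Matrix.one_apply, eq_comm (a := i), ← hcb, ← e.sum_inner_mul_inner (c i) (b j),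
      real_inner_comm (c i)]
  rw [Basis.det_apply, Basis.det_apply, ← Matrix.det_transpose (e.toBasis.toMatrix c),
    ← Matrix.det_mul, pairing, Matrix.det_one]

variable [FiniteDimensional ℝ E] [MeasurableSpace E] [BorelSpace E]

theorem covolume_span_eq_abs_det {ι : Type*} [Fintype ι] [DecidableEq ι]
    (e : OrthonormalBasis ι ℝ E) (b : Basis ι ℝ E) :
    ZLattice.covolume (Submodule.span ℤ (Set.range b)) = |e.toBasis.det b| := by
  rw [ZLattice.covolume_eq_measure_fundamentalDomain _ volume
      (ZSpan.isAddFundamentalDomain b volume),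
    ZSpan.measureReal_fundamentalDomain b volume e.toBasis,
    measureReal_congr (ZSpan.fundamentalDomain_ae_parallelepiped e.toBasis volume),
    measureReal_def, OrthonormalBasis.coe_toBasis, e.volume_parallelepiped, ENNReal.toReal_one,
    mul_one]

theorem covolume_dualSubmodule (L : Submodule ℤ E) [DiscreteTopology L] [IsZLattice ℝ L] :
    ZLattice.covolume (LinearMap.BilinForm.dualSubmodule (innerₗ E) L) =
      (ZLattice.covolume L)⁻¹ := by
  classical
  let b := (Free.chooseBasis ℤ L).ofZLatticeBasis ℝ L
  let e := (stdOrthonormalBasis ℝ E).reindex ((stdOrthonormalBasis ℝ E).toBasis.indexEquiv b)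
  have hL : Submodule.span ℤ (Set.range b) = L := (Free.chooseBasis ℤ L).ofZLatticeBasis_span ℝ
  have hdual : LinearMap.BilinForm.dualSubmodule (innerₗ E) L = Submodule.span ℤ
      (Set.range (LinearMap.BilinForm.dualBasis (innerₗ E) nondegenerate_innerₗ b)) := by
    rw [← LinearMap.BilinForm.dualSubmodule_span_of_basis, hL]
  have hcov : ZLattice.covolume L = |e.toBasis.det b| := by
    rw [← covolume_span_eq_abs_det e b, hL]
  rw [hdual, covolume_span_eq_abs_det e, hcov]
  exact eq_inv_of_mul_eq_one_left (by rw [← abs_mul, det_dualBasis_mul_det, abs_one])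

end Covolume

section LatticeSums

open scoped Pointwise in
theorem hasSum_setIntegral_vadd {Λ α G : Type*} [AddGroup Λ] [Countable Λ] [AddAction Λ α]
    [MeasurableSpace α] [MeasurableConstVAdd Λ α] {μ : Measure α} [VAddInvariantMeasure Λ α μ]
    [NormedAddCommGroup G] [NormedSpace ℝ G] {D : Set α} (hD : IsAddFundamentalDomain Λ D μ)
    {f : α → G} (hf : Integrable f μ) :
    HasSum (fun v : Λ => ∫ x in D, f (v +ᵥ x) ∂μ) (∫ x, f x ∂μ) := by
  have translates : HasSum (fun v : Λ => ∫ x in v +ᵥ D, f x ∂μ) (∫ x, f x ∂μ) := by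
    simpa only [hD.sum_restrict] using
      hasSum_integral_measure (μ := fun v : Λ => μ.restrict (v +ᵥ D)) (by rwa [hD.sum_restrict])
  convert translates using 2 with v
  exact ((measurePreserving_vadd v μ).setIntegral_image_emb
    (measurableEmbedding_const_vadd v) f D).symm

variable {E G : Type*} [NormedAddCommGroup E] [NormedSpace ℝ E] [FiniteDimensional ℝ E]
  [MeasurableSpace E] [BorelSpace E] {μ : Measure E} [μ.IsAddHaarMeasure]
  [NormedAddCommGroup G] [NormedSpace ℝ G] [CompleteSpace G]
  {L : Submodule ℤ E} [DiscreteTopology L] [IsZLattice ℝ L] {D : Set E}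

theorem norm_covolume_smul_tsum_sub_integral_le (hD : IsAddFundamentalDomain L D μ)
    {g : E → G} {w : E → ℝ} (hg : Integrable g μ) (hw : Integrable w μ)
    (hgw : ∀ v : L, ∀ x ∈ D, ‖g v - g (v + x)‖ ≤ w (v + x)) :
    ‖ZLattice.covolume L μ • ∑' v : L, g v - ∫ x, g x ∂μ‖ ≤ ∫ x, w x ∂μ := by
  have : MeasurableVAdd L E := inferInstanceAs (MeasurableVAdd L.toAddSubgroup E)
  have : VAddInvariantMeasure L E μ :=
    inferInstanceAs (VAddInvariantMeasure L.toAddSubgroup E μ)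
  have hD_fin : μ D ≠ ⊤ := fun htop => ZLattice.covolume_ne_zero L μ (by
    rw [ZLattice.covolume_eq_measure_fundamentalDomain L μ hD, measureReal_def, htop,
      ENNReal.toReal_top])
  have hg_sum : HasSum (fun v : L => ∫ x in D, g (v + x) ∂μ) (∫ x, g x ∂μ) :=
    hasSum_setIntegral_vadd hD hg
  have hw_sum : HasSum (fun v : L => ∫ x in D, w (v + x) ∂μ) (∫ x, w x ∂μ) :=
    hasSum_setIntegral_vadd hD hw
  have cell_bound (v : L) :
      ‖ZLattice.covolume L μ • g v - ∫ x in D, g (v + x) ∂μ‖ ≤ ∫ x in D, w (v + x) ∂μ := by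
    have hconst : Integrable (fun _ => g v) (μ.restrict D) := integrableOn_const hD_fin
    rw [ZLattice.covolume_eq_measure_fundamentalDomain L μ hD, ← setIntegral_const,
      ← integral_sub hconst (hg.comp_add_left (v : E)).integrableOn]
    refine norm_integral_le_of_norm_le (hw.comp_add_left (v : E)).integrableOn ?_
    exact (ae_restrict_iff'₀ hD.nullMeasurableSet).2 (ae_of_all _ (hgw v))
  have hcov_sum : Summable fun v : L => ZLattice.covolume L μ • g v := by
    simpa using (Summable.of_norm_bounded hw_sum.summable cell_bound).add hg_sum.summable
  rw [← tsum_const_smul'']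
  exact (hcov_sum.hasSum.sub hg_sum).norm_le_of_bounded hw_sum cell_bound

end LatticeSums

section Truncation

variable {E G : Type*} [NormedAddCommGroup E] [NormedAddCommGroup G]

theorem norm_indicator_closedBall_sub_le {f : E → G} {R C M : ℝ} {K : NNReal} (hR : 0 ≤ R)
    (hM : ∀ x ∈ closedBall (0 : E) R, ‖f x‖ ≤ M) (hK : LipschitzOnWith K f (closedBall 0 R))
    {x y : E} (hxy : ‖x - y‖ ≤ C) :
    ‖(closedBall 0 R).indicator f x - (closedBall 0 R).indicator f y‖ ≤
      (closedBall 0 R).indicator (fun _ => K * C) y +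
        (closedBall 0 (R + C) \ ball 0 (R - C)).indicator (fun _ => M) y := by
  have hC : 0 ≤ C := (norm_nonneg _).trans hxy
  have hM_nonneg : 0 ≤ M := (norm_nonneg _).trans (hM 0 (mem_closedBall_self hR))
  have interior_nonneg : 0 ≤ (closedBall (0 : E) R).indicator (fun _ => K * C) y :=
    Set.indicator_nonneg (fun _ _ => by positivity) y
  have boundary_nonneg :
      0 ≤ (closedBall (0 : E) (R + C) \ ball 0 (R - C)).indicator (fun _ => M) y :=
    Set.indicator_nonneg (fun _ _ => hM_nonneg) y
  have norm_le_of_crossing (hcross : R - C ≤ ‖y‖ ∧ ‖y‖ ≤ R + C) {z : E}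
      (hz : z ∈ closedBall (0 : E) R) :
      ‖f z‖ ≤ (closedBall 0 R).indicator (fun _ => K * C) y +
        (closedBall 0 (R + C) \ ball 0 (R - C)).indicator (fun _ => M) y := by
    rw [Set.indicator_of_mem (s := _ \ _) (by simpa [and_comm] using hcross)]
    exact le_add_of_nonneg_of_le interior_nonneg (hM z hz)
  have hxy_norm : |‖x‖ - ‖y‖| ≤ C := (abs_norm_sub_norm_le x y).trans hxy
  rw [abs_le] at hxy_norm
  by_cases hx : x ∈ closedBall (0 : E) R <;> by_cases hy : y ∈ closedBall (0 : E) R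
  · rw [Set.indicator_of_mem hx, Set.indicator_of_mem hy, Set.indicator_of_mem hy]
    refine le_add_of_le_of_nonneg ?_ boundary_nonneg
    exact (hK.norm_sub_le hx hy).trans (by gcongr)
  · rw [Set.indicator_of_mem hx, Set.indicator_of_notMem (f := f) hy, sub_zero]
    rw [mem_closedBall_zero_iff] at hx hy
    exact norm_le_of_crossing ⟨by linarith, by linarith⟩ (mem_closedBall_zero_iff.2 hx)
  · rw [Set.indicator_of_notMem hx, Set.indicator_of_mem (f := f) hy, zero_sub, norm_neg]
    rw [mem_closedBall_zero_iff] at hx hy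
    exact norm_le_of_crossing ⟨by linarith, by linarith⟩ (mem_closedBall_zero_iff.2 hy)
  · rw [Set.indicator_of_notMem hx, Set.indicator_of_notMem (f := f) hy, sub_zero, norm_zero]
    exact add_nonneg interior_nonneg boundary_nonneg

variable [NormedSpace ℝ E] [FiniteDimensional ℝ E] [MeasurableSpace E] [BorelSpace E]
  (μ : Measure E) [μ.IsAddHaarMeasure]

theorem measureReal_closedBall_sdiff_ball_le {R C : ℝ} (hC : 0 ≤ C) (hCR : C < R) :
    μ.real (closedBall 0 (R + C) \ ball 0 (R - C)) ≤
      2 * C * finrank ℝ E * (2 * R) ^ (finrank ℝ E - 1) * μ.real (ball 0 1) := by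
  set n := finrank ℝ E
  have hball : μ.real (ball 0 (R - C)) = (R - C) ^ n * μ.real (ball 0 1) := by
    rw [measureReal_def, Measure.addHaar_ball_of_pos _ _ (by linarith), ENNReal.toReal_mul,
      ENNReal.toReal_ofReal (pow_nonneg (by linarith) n), measureReal_def]
  have hpow : (R + C) ^ n - (R - C) ^ n ≤ 2 * C * n * (2 * R) ^ (n - 1) :=
    calc (R + C) ^ n - (R - C) ^ n
        ≤ |R + C - (R - C)| * n * max |R + C| |R - C| ^ (n - 1) :=
          (le_abs_self _).trans (abs_pow_sub_pow_le _ _ n)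
      _ = 2 * C * n * (R + C) ^ (n - 1) := by
          rw [abs_of_nonneg (by linarith), abs_of_nonneg (by linarith : 0 ≤ R + C),
            abs_of_nonneg (by linarith : 0 ≤ R - C), max_eq_left (by linarith)]
          ring
      _ ≤ 2 * C * n * (2 * R) ^ (n - 1) := by gcongr <;> linarith
  rw [measureReal_sdiff (ball_subset_closedBall.trans (closedBall_subset_closedBall (by linarith)))
      measurableSet_ball measure_closedBall_lt_top.ne,
    Measure.addHaar_real_closedBall _ _ (by linarith), hball, ← sub_mul]
  gcongr

end Truncation

section CountingError

variable {E G : Type*} [NormedAddCommGroup E] [NormedSpace ℝ E] [FiniteDimensional ℝ E]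
  [MeasurableSpace E] [BorelSpace E] {μ : Measure E} [μ.IsAddHaarMeasure]
  [NormedAddCommGroup G] [NormedSpace ℝ G] [CompleteSpace G]
  {L : Submodule ℤ E} [DiscreteTopology L] [IsZLattice ℝ L]

theorem norm_covolume_smul_tsum_indicator_sub_le {D : Set E} (hD : IsAddFundamentalDomain L D μ)
    {f : E → G} {R C M : ℝ} {K : NNReal} (hC : 0 ≤ C) (hCR : C < R) (hDC : ∀ x ∈ D, ‖x‖ ≤ C)
    (hM : ∀ x ∈ closedBall (0 : E) R, ‖f x‖ ≤ M) (hK : LipschitzOnWith K f (closedBall 0 R))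
    (h : E) :
    ‖ZLattice.covolume L μ • ∑' v : L, (closedBall 0 R).indicator f (v + h) -
        ∫ x in closedBall 0 R, f x ∂μ‖ ≤
      C * (K * R ^ finrank ℝ E +
        M * (2 * finrank ℝ E * (2 * R) ^ (finrank ℝ E - 1))) * μ.real (ball 0 1) := by
  have hR : 0 ≤ R := hC.trans hCR.le
  set B : Set E := closedBall 0 R
  set A : Set E := closedBall 0 (R + C) \ ball 0 (R - C)
  have hB : MeasurableSet B := measurableSet_closedBall
  have hA : MeasurableSet A := measurableSet_closedBall.diff measurableSet_ball
  have hf_int : Integrable (B.indicator f) μ := (integrable_indicator_iff hB).2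
    (hK.continuousOn.integrableOn_compact (isCompact_closedBall _ _))
  have hB_int : Integrable (B.indicator fun _ => K * C) μ := (integrable_indicator_iff hB).2
    (integrableOn_const measure_closedBall_lt_top.ne)
  have hA_int : Integrable (A.indicator fun _ => M) μ := (integrable_indicator_iff hA).2
    (integrableOn_const (measure_ne_top_of_subset Set.sdiff_subset measure_closedBall_lt_top.ne))
  have hM_nonneg : 0 ≤ M := (norm_nonneg _).trans (hM 0 (mem_closedBall_self hR))
  have oscillation (v : L) (x : E) (hx : x ∈ D) :
      ‖B.indicator f (v + h) - B.indicator f (v + x + h)‖ ≤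
        B.indicator (fun _ => K * C) (v + x + h) + A.indicator (fun _ => M) (v + x + h) :=
    norm_indicator_closedBall_sub_le hR hM hK (by
      simpa [add_right_comm (v : E) x h] using hDC x hx)
  calc
    _ = ‖ZLattice.covolume L μ • ∑' v : L, B.indicator f (v + h) -
          ∫ x, B.indicator f (x + h) ∂μ‖ := by
        rw [integral_add_right_eq_self (B.indicator f) h, integral_indicator hB]
    _ ≤ ∫ x, (B.indicator (fun _ => K * C) (x + h) + A.indicator (fun _ => M) (x + h)) ∂μ :=
        norm_covolume_smul_tsum_sub_integral_le hD (hf_int.comp_add_right h)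
          ((hB_int.add hA_int).comp_add_right h) oscillation
    _ = μ.real B * (K * C) + μ.real A * M := by
        rw [integral_add_right_eq_self
            (fun x => B.indicator (fun _ => K * C) x + A.indicator (fun _ => M) x) h,
          integral_add hB_int hA_int, integral_indicator_const _ hB, integral_indicator_const _ hA,
          smul_eq_mul, smul_eq_mul]
    _ ≤ R ^ finrank ℝ E * μ.real (ball 0 1) * (K * C) +
          2 * C * finrank ℝ E * (2 * R) ^ (finrank ℝ E - 1) * μ.real (ball 0 1) * M := by
        rw [Measure.addHaar_real_closedBall μ 0 hR]
        gcongr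
        exact measureReal_closedBall_sdiff_ball_le μ hC hCR
    _ = _ := by ring

end CountingError

section Homogeneous

variable {E G : Type*} [NormedAddCommGroup E] [NormedSpace ℝ E]
  [NormedAddCommGroup G] [NormedSpace ℝ G]

open scoped Pointwise in
theorem inv_smul_mem_unitClosedBall {R : ℝ} (hR : 0 < R) {x : E} (hx : x ∈ closedBall 0 R) :
    R⁻¹ • x ∈ closedBall (0 : E) 1 := by
  rwa [← Set.mem_smul_set_iff_inv_smul_mem₀ hR.ne', smul_unitClosedBall_of_nonneg hR.le]

/-- `f` is positively homogeneous of degree `d`. The scaling law is only required for positive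
factors, so that `d` may be any real number. -/
def IsPosHomogeneous (d : ℝ) (f : E → G) : Prop :=
  ∀ ⦃r : ℝ⦄, 0 < r → ∀ x, f (r • x) = r ^ d • f x

namespace IsPosHomogeneous

variable {d : ℝ} {f : E → G} {K : NNReal} {R : ℝ}

theorem eq_rpow_smul (hf : IsPosHomogeneous d f) (hR : 0 < R) (x : E) :
    f x = R ^ d • f (R⁻¹ • x) := by
  rw [← hf hR, smul_inv_smul₀ hR.ne']

theorem norm_le (hf : IsPosHomogeneous d f) (hK : LipschitzOnWith K f (closedBall 0 1))
    (hR : 0 < R) {x : E} (hx : x ∈ closedBall 0 R) : ‖f x‖ ≤ (‖f 0‖ + K) * R ^ d := by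
  have hx' : R⁻¹ • x ∈ closedBall (0 : E) 1 := inv_smul_mem_unitClosedBall hR hx
  have unit_bound : ‖f (R⁻¹ • x)‖ ≤ ‖f 0‖ + K :=
    calc ‖f (R⁻¹ • x)‖ ≤ ‖f 0‖ + ‖f (R⁻¹ • x) - f 0‖ := norm_le_norm_add_norm_sub' _ _
      _ ≤ ‖f 0‖ + K * ‖R⁻¹ • x - 0‖ := by
          gcongr
          exact hK.norm_sub_le hx' (mem_closedBall_self zero_le_one)
      _ ≤ ‖f 0‖ + K := by
          rw [sub_zero]
          gcongr
          exact mul_le_of_le_one_right K.2 (mem_closedBall_zero_iff.1 hx')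
  rw [hf.eq_rpow_smul hR x, norm_smul, Real.norm_of_nonneg (by positivity), mul_comm]
  gcongr

theorem lipschitzOnWith_closedBall (hf : IsPosHomogeneous d f)
    (hK : LipschitzOnWith K f (closedBall 0 1)) (hR : 0 < R) :
    LipschitzOnWith (K * (R ^ (d - 1)).toNNReal) f (closedBall 0 R) := by
  refine LipschitzOnWith.of_dist_le_mul fun x hx y hy => ?_
  rw [dist_eq_norm, dist_eq_norm, NNReal.coe_mul, Real.coe_toNNReal _ (by positivity)]
  calc ‖f x - f y‖ = R ^ d * ‖f (R⁻¹ • x) - f (R⁻¹ • y)‖ := by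
        rw [hf.eq_rpow_smul hR x, hf.eq_rpow_smul hR y, ← smul_sub, norm_smul,
          Real.norm_of_nonneg (by positivity)]
    _ ≤ R ^ d * (K * ‖R⁻¹ • x - R⁻¹ • y‖) := by
        gcongr
        exact hK.norm_sub_le (inv_smul_mem_unitClosedBall hR hx) (inv_smul_mem_unitClosedBall hR hy)
    _ = K * R ^ (d - 1) * ‖x - y‖ := by
        rw [← smul_sub, norm_smul, norm_inv, Real.norm_of_nonneg hR.le, Real.rpow_sub_one hR.ne']
        ring

theorem setIntegral_closedBall [FiniteDimensional ℝ E] [MeasurableSpace E] [BorelSpace E]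
    (μ : Measure E) [μ.IsAddHaarMeasure] (hf : IsPosHomogeneous d f) (hR : 0 < R) :
    ∫ x in closedBall 0 R, f x ∂μ =
      R ^ (d + finrank ℝ E) • ∫ x in closedBall 0 1, f x ∂μ := by
  have scaling := Measure.setIntegral_comp_smul_of_pos μ f (closedBall 0 1) hR
  simp only [hf hR, integral_smul, smul_unitClosedBall_of_nonneg hR.le] at scaling
  rw [Real.rpow_add hR, Real.rpow_natCast, mul_comm, mul_smul, scaling,
    smul_inv_smul₀ (by positivity)]

end IsPosHomogeneous

end Homogeneous

section HomogeneousSums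

variable {E G : Type*} [NormedAddCommGroup E] [NormedSpace ℝ E] [FiniteDimensional ℝ E]

theorem exists_norm_le_finrank_mul {D : Set E} (hD : Bornology.IsBounded D) :
    ∃ C : ℝ, 0 ≤ C ∧ ∀ x ∈ D, ‖x‖ ≤ finrank ℝ E * C := by
  obtain ⟨C, hC, hDC⟩ := hD.exists_pos_norm_le
  refine ⟨C, hC.le, fun x hx => ?_⟩
  rcases subsingleton_or_nontrivial E with _ | _
  · rw [norm_of_subsingleton]
    positivity
  · have : (1 : ℝ) ≤ finrank ℝ E := by exact_mod_cast finrank_pos (R := ℝ) (M := E)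
    exact (hDC x hx).trans (le_mul_of_one_le_left hC.le this)

theorem natCast_mul_pow_sub_one (n : ℕ) (R : ℝ) :
    n * R ^ (n - 1) = n * R ^ ((n : ℝ) - 1) := by
  cases n <;> simp

variable [MeasurableSpace E] [BorelSpace E] {μ : Measure E} [μ.IsAddHaarMeasure]
  [NormedAddCommGroup G] [NormedSpace ℝ G] [CompleteSpace G]
  {L : Submodule ℤ E} [DiscreteTopology L] [IsZLattice ℝ L]

theorem IsPosHomogeneous.norm_covolume_smul_tsum_sub_le {D : Set E}
    (hD : IsAddFundamentalDomain L D μ) {d R C : ℝ} {f : E → G} {K : NNReal} (hC : 0 ≤ C)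
    (hCR : C < R) (hDC : ∀ x ∈ D, ‖x‖ ≤ C) (hf : IsPosHomogeneous d f)
    (hK : LipschitzOnWith K f (closedBall 0 1)) (h : E) :
    ‖ZLattice.covolume L μ • ∑' v : L, (closedBall 0 R).indicator f (v + h) -
        R ^ (d + finrank ℝ E) • ∫ x in closedBall 0 1, f x ∂μ‖ ≤
      C * ((K + (‖f 0‖ + K) * (2 * finrank ℝ E * 2 ^ (finrank ℝ E - 1))) * μ.real (ball 0 1)) *
        R ^ (d + finrank ℝ E - 1) := by
  have hR : 0 < R := hC.trans_lt hCR
  set n := finrank ℝ E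
  have interior : R ^ (d - 1) * R ^ n = R ^ (d + n - 1) := by
    rw [← Real.rpow_natCast R n, ← Real.rpow_add hR]
    ring_nf
  have boundary : R ^ d * (n * R ^ (n - 1)) = n * R ^ (d + n - 1) := by
    rw [natCast_mul_pow_sub_one n R, mul_left_comm, ← Real.rpow_add hR]
    ring_nf
  rw [← hf.setIntegral_closedBall μ hR]
  calc
    _ ≤ C * ((K * (R ^ (d - 1)).toNNReal : NNReal) * R ^ n +
          (‖f 0‖ + K) * R ^ d * (2 * n * (2 * R) ^ (n - 1))) * μ.real (ball 0 1) :=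
        norm_covolume_smul_tsum_indicator_sub_le hD hC hCR hDC (fun x hx => hf.norm_le hK hR hx)
          (hf.lipschitzOnWith_closedBall hK hR) h
    _ = C * (K * (R ^ (d - 1) * R ^ n) +
          (‖f 0‖ + K) * (2 * 2 ^ (n - 1)) * (R ^ d * (n * R ^ (n - 1)))) * μ.real (ball 0 1) := by
        rw [NNReal.coe_mul, Real.coe_toNNReal _ (by positivity), mul_pow]
        ring
    _ = _ := by
        rw [interior, boundary]
        ring

/-- The factor `finrank ℝ E` makes the error vanish in dimension `0`, where the correction
`-2 / (n + 1)` to the exponent in `mainTheorem1` is smaller than `-1`. -/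
theorem mainTheorem1_general (L : Submodule ℤ E) [DiscreteTopology L] [IsZLattice ℝ L] {d : ℝ}
    {f : E → G} {K : NNReal} (hf : IsPosHomogeneous d f)
    (hK : LipschitzOnWith K f (closedBall 0 1)) (h : E) :
    (fun R : ℝ => ∑' v : L, (closedBall 0 R).indicator f (v + h) -
        R ^ (d + finrank ℝ E) • (ZLattice.covolume L μ)⁻¹ • ∫ x in closedBall 0 1, f x ∂μ)
      =O[atTop] fun R : ℝ => finrank ℝ E * R ^ (d + finrank ℝ E - 1) := by
  let b := Free.chooseBasis ℤ L
  have hD := ZLattice.isAddFundamentalDomain b μ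
  obtain ⟨C, hC, hDC⟩ := exists_norm_le_finrank_mul
    (ZSpan.fundamentalDomain_isBounded (b.ofZLatticeBasis ℝ L))
  have hcov : 0 < ZLattice.covolume L μ := ZLattice.covolume_pos L μ
  set n := finrank ℝ E
  set A := (K + (‖f 0‖ + K) * (2 * n * 2 ^ (n - 1))) * μ.real (ball 0 1)
  refine IsBigO.of_bound ((ZLattice.covolume L μ)⁻¹ * C * A) ?_
  filter_upwards [eventually_gt_atTop (n * C), eventually_gt_atTop 0] with R hCR hR
  calc
    _ = (ZLattice.covolume L μ)⁻¹ *
          ‖ZLattice.covolume L μ • ∑' v : L, (closedBall 0 R).indicator f (v + h) -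
            R ^ (d + n) • ∫ x in closedBall 0 1, f x ∂μ‖ := by
        rw [← norm_smul_of_nonneg (inv_nonneg.2 hcov.le), smul_sub, inv_smul_smul₀ hcov.ne',
          smul_comm (R ^ _)]
    _ ≤ (ZLattice.covolume L μ)⁻¹ * (n * C * A * R ^ (d + n - 1)) := by
        gcongr
        exact hf.norm_covolume_smul_tsum_sub_le hD (by positivity) hCR hDC hK h
    _ = (ZLattice.covolume L μ)⁻¹ * C * A * ‖n * R ^ (d + n - 1)‖ := by
        rw [Real.norm_of_nonneg (by positivity)]
        ring

end HomogeneousSums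

section Polynomials

variable {n d : ℕ} {F : MvPolynomial (Fin n) ℝ}

theorem isPosHomogeneous_polyFun (hF : F.IsHomogeneous d) : IsPosHomogeneous d (polyFun F) := by
  intro r _ x
  simp only [polyFun, MvPolynomial.eval_eq, Finset.mul_sum, PiLp.smul_apply, smul_eq_mul, mul_pow,
    Finset.prod_mul_distrib, Finset.prod_pow_eq_pow_sum, Real.rpow_natCast]
  refine Finset.sum_congr rfl fun m hm => ?_
  rw [← hF.degree_eq_sum_deg_support hm, mul_left_comm]

theorem contDiff_polyFun (F : MvPolynomial (Fin n) ℝ) (k : WithTop ℕ∞) :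
    ContDiff ℝ k (polyFun F) :=
  contDiffOn_univ.1 ((AnalyticOnNhd.eval_continuousLinearMap'
    (fun i => (EuclideanSpace.proj i : EuclideanSpace ℝ (Fin n) →L[ℝ] ℝ)) F).contDiffOn
      uniqueDiffOn_univ)

theorem exists_lipschitzOnWith_polyFun (F : MvPolynomial (Fin n) ℝ) (r : ℝ) :
    ∃ K, LipschitzOnWith K (polyFun F) (closedBall 0 r) :=
  (contDiff_polyFun F 1).contDiffOn.exists_lipschitzOnWith one_ne_zero (convex_closedBall 0 r)
    (isCompact_closedBall 0 r)

theorem shiftedWeightedCount_zero (F : MvPolynomial (Fin n) ℝ)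
    (Γ : Submodule ℤ (EuclideanSpace ℝ (Fin n))) (R : ℝ) :
    shiftedWeightedCount F Γ 0 R = weightedCount F Γ R := by
  simp only [weightedCount, shiftedWeightedCount, add_zero]

theorem isBigO_shiftedWeightedCount_sub (hF : F.IsHomogeneous d)
    (Γ : Submodule ℤ (EuclideanSpace ℝ (Fin n))) [DiscreteTopology Γ] [IsZLattice ℝ Γ]
    (h : EuclideanSpace ℝ (Fin n)) :
    (fun R : ℝ => shiftedWeightedCount F Γ h R -
        (ZLattice.covolume (dualLattice Γ) * ∫ x in closedBall 0 1, polyFun F x) * R ^ (d + n))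
      =O[atTop] fun R : ℝ => n * R ^ ((d : ℝ) + n - 1) := by
  obtain ⟨K, hK⟩ := exists_lipschitzOnWith_polyFun F 1
  have asymptotic :=
    mainTheorem1_general (μ := volume) Γ (isPosHomogeneous_polyFun hF) hK h
  rw [finrank_euclideanSpace_fin] at asymptotic
  refine asymptotic.congr_left fun R => ?_
  rw [dualLattice, covolume_dualSubmodule, smul_eq_mul, smul_eq_mul, mul_comm (R ^ _),
    ← Nat.cast_add, Real.rpow_natCast]
  rfl

end Polynomials

theorem isBigO_natCast_mul_rpow_sub_one (n : ℕ) (s : ℝ) :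
    (fun R : ℝ => n * R ^ (s - 1)) =O[atTop] fun R : ℝ => R ^ (s - 2 / ((n : ℝ) + 1)) := by
  rcases n.eq_zero_or_pos with rfl | hn
  · simpa using isBigO_zero _ _
  · have hn' : (1 : ℝ) ≤ n := by exact_mod_cast hn
    have exponent : s - 1 ≤ s - 2 / ((n : ℝ) + 1) := by
      gcongr
      rw [div_le_one] <;> linarith
    refine IsBigO.const_mul_left (IsBigO.of_bound 1 ?_) _
    filter_upwards [eventually_ge_atTop 1] with R hR
    rw [one_mul, Real.norm_of_nonneg (by positivity), Real.norm_of_nonneg (by positivity)]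
    exact Real.rpow_le_rpow_of_exponent_le hR exponent

theorem mainTheorem1 (n d : ℕ) (hd : 1 ≤ d) (F : MvPolynomial (Fin n) ℝ)
    (hF : F.IsHomogeneous d) (Γ : Submodule ℤ (EuclideanSpace ℝ (Fin n)))
    [DiscreteTopology Γ] [IsZLattice ℝ Γ] :
    ((fun R : ℝ => weightedCount F Γ R -
        (ZLattice.covolume (dualLattice Γ) *
          ∫ x in Metric.closedBall (0 : EuclideanSpace ℝ (Fin n)) 1, polyFun F x) * R ^ (d + n))
      =O[atTop] fun R : ℝ => R ^ ((d : ℝ) + (n : ℝ) - 2 / ((n : ℝ) + 1))) ∧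
    ∀ h : EuclideanSpace ℝ (Fin n),
      (fun R : ℝ => shiftedWeightedCount F Γ h R -
        (ZLattice.covolume (dualLattice Γ) *
          ∫ x in Metric.closedBall (0 : EuclideanSpace ℝ (Fin n)) 1, polyFun F x) * R ^ (d + n))
      =O[atTop] fun R : ℝ => R ^ ((d : ℝ) + (n : ℝ) - 2 / ((n : ℝ) + 1)) := by
  have shifted (h : EuclideanSpace ℝ (Fin n)) :=
    (isBigO_shiftedWeightedCount_sub hF Γ h).trans (isBigO_natCast_mul_rpow_sub_one n (d + n))
  exact ⟨by simpa only [shiftedWeightedCount_zero] using shifted 0, shifted⟩
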